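/- Let $n\ge 1$ be an integer, $\theta\in(0,\frac{\pi}{2})$, $\gamma>0$, $N>0$. Write points of $\mathbb{R}^{n+1}$ as $\xi=(\xi',\xi_{n+1})$, let $e=-E_{n+1}=(0,\dots,0,-1)$, and let $$\mathcal{C}^n_\theta=\{\xi\in\mathbb{R}^{n+1}:\ \xi_{n+1}\ge 0,\ |\xi-\cos\theta\, e|=1\}$$ be the capillary spherical cap, with its induced metric, Levi-Civita connection $\nabla$, and outward unit conormal $\mu$ along $\partial\mathcal{C}^n_\theta=\mathcal{C}^n_\theta\cap\{\xi_{n+1}=0\}$. Then there is a constant $C$, depending only on $n,\theta,\gamma,N$, with the following property. Let $h\in C^\infty(\mathcal{C}^n_\theta)$ be an even and strictly convex capillary support function, that is, - (evenness) $h(-\xi',\xi_{n+1})=h(\xi',\xi_{n+1})$ for all $\xi\in\mathcal{C}^n_\theta$; - (strict convexity) $\nabla^2h+h I>0$ on $\mathcal{C}^n_\theta$; - (capillary boundary condition) $\nabla_\mu h=\cot\theta\, h$ on $\partial\mathcal{C}^n_\theta$. If $$\frac{|\nabla h|^2}{h^{\gamma}}\le N\Big(\max_{\mathcal{C}^n_\theta}h\Big)^{2-\gamma}\quad\text{on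 }\mathcal{C}^n_\theta,$$ then $\min_{\mathcal{C}^n_\theta}h>0$ and $$\frac{\max_{\mathcal{C}^n_\theta}h}{\min_{\mathcal{C}^n_\theta}h}\le C.$$ (The positivity of $h$ is a consequence of evenness, strict convexity and the boundary condition, so that $h^\gamma$ is well defined.) -/

import Mathlib

open scoped ContDiff InnerProductSpace

noncomputable section

namespace Capillary

/-- The Euclidean space `ℝ^{n+1}`; points are written `ξ = (ξ', ξ_{n+1})`, the coordinate
`ξ_{n+1}` being the one with index `Fin.last n`. -/
abbrev Space (n : ℕ) : Type := EuclideanSpace ℝ (Fin (n + 1))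

/-- The downward unit vector `e = -E_{n+1}`. -/
def down (n : ℕ) : Space n := -EuclideanSpace.single (Fin.last n) (1 : ℝ)

/-- The capillary spherical cap
`C^n_θ = {ζ : ζ_{n+1} ≥ 0, |ζ - cos θ e| = 1}`. -/
def cap (n : ℕ) (θ : ℝ) : Set (Space n) :=
  {ζ | 0 ≤ ζ (Fin.last n) ∧ ‖ζ - Real.cos θ • down n‖ = 1}

/-- The boundary `∂C^n_θ = C^n_θ ∩ {ζ_{n+1} = 0}`. -/
def capBoundary (n : ℕ) (θ : ℝ) : Set (Space n) :=
  {ζ | ζ ∈ cap n θ ∧ ζ (Fin.last n) = 0}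

variable {n : ℕ}

/-- The outward unit normal `ξ - cos θ e` of the cap at `ξ`. The cap being a piece of a unit
sphere, `v` is tangent to it at `ξ` iff `⟪v, normal θ ξ⟫ = 0`. -/
def normal (θ : ℝ) (ξ : Space n) : Space n := ξ - Real.cos θ • down n

/-- The outward unit conormal of `∂C^n_θ` in `C^n_θ` at a boundary point `ξ`, namely
`μ = sin θ e + cos θ ν̄`, where `ν̄ = ξ / sin θ` is the outward unit normal of the sphere
`∂C^n_θ` (of radius `sin θ`) in the hyperplane `{ξ_{n+1} = 0}`. -/
def conormal (θ : ℝ) (ξ : Space n) : Space n :=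
  Real.sin θ • down n + (Real.cos θ / Real.sin θ) • ξ

/- A smooth function on the cap (a compact smooth manifold with boundary in `ℝ^{n+1}`) is the
restriction to the cap of a smooth function `h` on `ℝ^{n+1}`. The intrinsic gradient and Hessian
are computed from `h` below; they depend only on the restriction of `h` to the cap. -/

/-- The gradient `∇h` on the cap with its induced metric: the tangential part of the ambient
gradient. -/
def capGradient (θ : ℝ) (h : Space n → ℝ) (ξ : Space n) : Space n :=
  gradient h ξ - ⟪gradient h ξ, normal θ ξ⟫_ℝ • normal θ ξ

/-- The Hessian `∇²h` on the cap for the Levi-Civita connection of the induced metric, evaluated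
at tangent vectors `v`, `w` (Gauss formula for a unit sphere):
`∇²h(v, w) = D²h(v, w) - ⟪Dh, ν⟫ ⟪v, w⟫`. -/
def capHessian (θ : ℝ) (h : Space n → ℝ) (ξ v w : Space n) : ℝ :=
  fderiv ℝ (fderiv ℝ h) ξ v w - ⟪gradient h ξ, normal θ ξ⟫_ℝ * ⟪v, w⟫_ℝ

/-- Strict convexity of a function on the cap: `∇²h + h I` is positive definite on every tangent
space, up to the boundary. -/
def StrictlyConvex (θ : ℝ) (h : Space n → ℝ) : Prop :=
  ∀ ξ ∈ cap n θ, ∀ v : Space n, ⟪v, normal θ ξ⟫_ℝ = 0 → v ≠ 0 →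
    0 < capHessian θ h ξ v v + h ξ * ⟪v, v⟫_ℝ

/-- The capillary (Robin) boundary condition `∇_μ h = cot θ h` on `∂C^n_θ`. -/
def RobinCondition (θ : ℝ) (h : Space n → ℝ) : Prop :=
  ∀ ξ ∈ capBoundary n θ,
    ⟪capGradient θ h ξ, conormal θ ξ⟫_ℝ = (Real.cos θ / Real.sin θ) * h ξ

/-- The reflection `(ξ', ξ_{n+1}) ↦ (-ξ', ξ_{n+1})`. -/
def reflect (ξ : Space n) : Space n :=
  WithLp.toLp 2 fun i => if i = Fin.last n then ξ i else -ξ i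

/-- Evenness on the cap: `h(-ξ', ξ_{n+1}) = h(ξ', ξ_{n+1})`. -/
def IsEven (θ : ℝ) (h : Space n → ℝ) : Prop :=
  ∀ ξ ∈ cap n θ, h (reflect ξ) = h ξ

/-- The (restriction to the cap of the) function `h` is the capillary support function of a smooth
strictly convex hypersurface in the closed half-space with constant contact angle `θ`: it is
smooth, `∇²h + h I > 0`, and `∇_μ h = cot θ h` on the boundary. The hypersurface is then the image
of `ξ ↦ ∇h(ξ) + h(ξ) (ξ - cos θ e)`, its inverse capillary Gauss map. -/
structure IsCapillarySupport (θ : ℝ) (h : Space n → ℝ) : Prop where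
  smooth : ContDiff ℝ ∞ h
  strictlyConvex : StrictlyConvex θ h
  robin : RobinCondition θ h

/-- `max_{C^n_θ} h` (the cap is compact and nonempty for `0 < θ < π / 2`). -/
def capMax (θ : ℝ) (h : Space n → ℝ) : ℝ := sSup (h '' cap n θ)

/-- `min_{C^n_θ} h`. -/
def capMin (θ : ℝ) (h : Space n → ℝ) : ℝ := sInf (h '' cap n θ)

end Capillary

end

open scoped ContDiff InnerProductSpace

namespace Capillary

/-! ### One-variable comparison and growth estimates. -/

section Real

/-! Restrict `h` to great-circle arcs from the pole to the boundary. Strict convexity gives `f'' + f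
> 0` on each arc, evenness gives `f' 0 = 0`, and the Robin condition is `f' θ = cot θ * f θ`.
Wronskians with `cos` and `sin` then show that `f / cos` increases and `f / sin` decreases
(`oscillator_comparison`). The first fact bounds `min h` below by `cos θ` times the polar value.

It remains to bound the polar value below by a multiple of `max h`. On the arc through a maximum
point the endpoint value is at least `cos θ * max h`, so monotonicity of `f / sin` puts `g = f / max
h` above a linear cone `c * x`. The gradient hypothesis is scale invariant and reads `g' ^ 2 ≤ N * g
^ γ`: where `g` is small, so is its slope. A tiny `g 0` would keep `g` too flat to climb above the
cone (`exists_lower_bound_at_zero`). All arcs share the pole, which links the two estimates. -/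

/-- Comparison of `f` with `cos` and `sin` when `f'' + f > 0`, `f' 0 = 0` and
`f' θ = cot θ * f θ`. -/
theorem oscillator_comparison {θ : ℝ} (hθ : 0 < θ) (hθ' : θ < Real.pi / 2)
    {f f' f'' : ℝ → ℝ} (hf : ∀ x, HasDerivAt f (f' x) x) (hf' : ∀ x, HasDerivAt f' (f'' x) x)
    (hpos : ∀ x ∈ Set.Icc 0 θ, 0 < f'' x + f x) (h0 : f' 0 = 0)
    (hbd : f' θ * Real.sin θ = Real.cos θ * f θ) :
    0 < f 0 ∧ (∀ x ∈ Set.Icc 0 θ, f 0 * Real.cos x ≤ f x) ∧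
      (∀ x ∈ Set.Icc 0 θ, f x * Real.cos θ ≤ f θ * Real.cos x) ∧
      ∀ x ∈ Set.Icc 0 θ, f θ * Real.sin x ≤ f x * Real.sin θ := by
  have hcos : ∀ x ∈ Set.Icc 0 θ, 0 < Real.cos x := fun x hx =>
    Real.cos_pos_of_mem_Ioo ⟨by linarith [hx.1, Real.pi_pos], by linarith [hx.2]⟩
  have hsin : ∀ x ∈ Set.Ioc 0 θ, 0 < Real.sin x := fun x hx =>
    Real.sin_pos_of_pos_of_lt_pi hx.1 (by linarith [hx.2, Real.pi_pos])
  -- Wronskians with `cos` and `sin`: both increase strictly, `P` from 0 at 0 and `Q` up to 0 at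
  -- `θ`. Their signs are those of the derivatives of `f / cos` and `f / sin`, and `Q 0 = -f 0 < 0`
  -- yields positivity.
  set P : ℝ → ℝ := fun x => f' x * Real.cos x + f x * Real.sin x with hP
  set Q : ℝ → ℝ := fun x => f' x * Real.sin x - f x * Real.cos x with hQ
  have dP : ∀ x, HasDerivAt P ((f'' x + f x) * Real.cos x) x := fun x => by
    refine (((hf' x).mul (Real.hasDerivAt_cos x)).add
      ((hf x).mul (Real.hasDerivAt_sin x))).congr_deriv ?_
    ring
  have dQ : ∀ x, HasDerivAt Q ((f'' x + f x) * Real.sin x) x := fun x => by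
    refine (((hf' x).mul (Real.hasDerivAt_sin x)).sub
      ((hf x).mul (Real.hasDerivAt_cos x))).congr_deriv ?_
    ring
  have mP : StrictMonoOn P (Set.Icc 0 θ) :=
    strictMonoOn_of_deriv_pos (convex_Icc _ _)
      (fun x _ => (dP x).continuousAt.continuousWithinAt) fun x hx => by
        rw [interior_Icc] at hx
        rw [(dP x).deriv]
        exact mul_pos (hpos x ⟨hx.1.le, hx.2.le⟩) (hcos x ⟨hx.1.le, hx.2.le⟩)
  have mQ : StrictMonoOn Q (Set.Icc 0 θ) :=
    strictMonoOn_of_deriv_pos (convex_Icc _ _)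
      (fun x _ => (dQ x).continuousAt.continuousWithinAt) fun x hx => by
        rw [interior_Icc] at hx
        rw [(dQ x).deriv]
        exact mul_pos (hpos x ⟨hx.1.le, hx.2.le⟩) (hsin x ⟨hx.1, hx.2.le⟩)
  have hleft : (0 : ℝ) ∈ Set.Icc 0 θ := ⟨le_rfl, hθ.le⟩
  have hright : θ ∈ Set.Icc 0 θ := ⟨hθ.le, le_rfl⟩
  have P0 : P 0 = 0 := by simp [hP, h0]
  have Qθ : Q θ = 0 := by simp only [hQ]; linarith
  have nP : ∀ x ∈ Set.Icc 0 θ, 0 ≤ P x := fun x hx =>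
    P0 ▸ mP.monotoneOn hleft hx hx.1
  have nQ : ∀ x ∈ Set.Icc 0 θ, Q x ≤ 0 := fun x hx =>
    Qθ ▸ mQ.monotoneOn hx hright hx.2
  have mono : MonotoneOn (fun x => f x / Real.cos x) (Set.Icc 0 θ) := by
    have d : ∀ x ∈ Set.Icc 0 θ,
        HasDerivAt (fun x => f x / Real.cos x) (P x / Real.cos x ^ 2) x := fun x hx => by
      refine ((hf x).div (Real.hasDerivAt_cos x) (hcos x hx).ne').congr_deriv ?_
      simp only [hP]; ring
    refine monotoneOn_of_deriv_nonneg (convex_Icc _ _)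
      (fun x hx => (d x hx).continuousAt.continuousWithinAt)
      (fun x hx => (d x (interior_subset hx)).differentiableAt.differentiableWithinAt)
      fun x hx => ?_
    rw [(d x (interior_subset hx)).deriv]
    exact div_nonneg (nP x (interior_subset hx)) (sq_nonneg _)
  have anti : AntitoneOn (fun x => f x / Real.sin x) (Set.Ioc 0 θ) := by
    have d : ∀ x ∈ Set.Ioc 0 θ,
        HasDerivAt (fun x => f x / Real.sin x) (Q x / Real.sin x ^ 2) x := fun x hx => by
      refine ((hf x).div (Real.hasDerivAt_sin x) (hsin x hx).ne').congr_deriv ?_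
      simp only [hQ]
    refine antitoneOn_of_deriv_nonpos (convex_Ioc _ _)
      (fun x hx => (d x hx).continuousAt.continuousWithinAt)
      (fun x hx => (d x (interior_subset hx)).differentiableAt.differentiableWithinAt)
      fun x hx => ?_
    have hx' := interior_subset hx
    rw [(d x hx').deriv]
    exact div_nonpos_of_nonpos_of_nonneg (nQ x ⟨hx'.1.le, hx'.2⟩) (sq_nonneg _)
  have f0 : 0 < f 0 := by
    have := mQ hleft hright hθ
    rw [Qθ] at this
    simpa [hQ] using this
  refine ⟨f0, fun x hx => ?_, fun x hx => ?_, fun x hx => ?_⟩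
  · have := mono hleft hx hx.1
    simp only [Real.cos_zero, div_one] at this
    rwa [le_div_iff₀ (hcos x hx)] at this
  · have := mono hx hright hx.2
    rwa [div_le_div_iff₀ (hcos x hx) (hcos θ hright)] at this
  · rcases hx.1.eq_or_lt with rfl | hx0
    · have := mul_pos f0 (hsin θ ⟨hθ, le_rfl⟩)
      simpa using this.le
    · have := anti ⟨hx0, hx.2⟩ ⟨hθ, le_rfl⟩ hx.2
      rwa [div_le_div_iff₀ (hsin θ ⟨hθ, le_rfl⟩) (hsin x ⟨hx0, hx.2⟩)] at this

/-- A function lying above a cone `c * x`, with derivative controlled by a positive power of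
itself, is bounded below at `0`. -/
theorem exists_lower_bound_at_zero {θ c γ N : ℝ} (hθ : 0 < θ) (hc : 0 < c) (hγ : 0 < γ)
    (hN : 0 < N) :
    ∃ ε > 0, ∀ g g' : ℝ → ℝ, (∀ x, HasDerivAt g (g' x) x) →
      (∀ x ∈ Set.Icc 0 θ, 0 ≤ g x) → (∀ x ∈ Set.Icc 0 θ, g x ≤ 1) →
      (∀ x ∈ Set.Icc 0 θ, g' x ^ 2 ≤ N * g x ^ γ) → (∀ x ∈ Set.Icc 0 θ, c * x ≤ g x) →
      ε ≤ g 0 := by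
  set k := Real.sqrt N with hk
  have hk0 : 0 < k := Real.sqrt_pos.2 hN
  -- At this scale `y`, `g ≤ 2 * k * y` forces a slope below `c / 2`; such `y` exists because `γ >
  -- 0`.
  obtain ⟨y, ⟨hy0, hyθ⟩, hy⟩ : ∃ y ∈ Set.Ioo 0 θ, N * (2 * k * y) ^ γ < (c / 2) ^ 2 := by
    have hcont : ContinuousAt (fun y : ℝ => N * (2 * k * y) ^ γ) 0 :=
      continuousAt_const.mul
        ((continuousAt_const.mul continuousAt_id).rpow_const (Or.inr hγ.le))
    have hlt : N * (2 * k * 0) ^ γ < (c / 2) ^ 2 := by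
      rw [mul_zero, Real.zero_rpow hγ.ne', mul_zero]; positivity
    have hev := (hcont.eventually_lt continuousAt_const hlt).filter_mono
      (nhdsWithin_le_nhds (s := Set.Ioi 0))
    obtain ⟨y, h1, h2⟩ := (hev.and (Ioo_mem_nhdsGT hθ)).exists
    exact ⟨y, h2, h1⟩
  refine ⟨min (k * y) (c * y / 2), by positivity, fun g g' hg h0 h1 hd hcone => ?_⟩
  by_contra! hlt
  have hεk := hlt.trans_le (min_le_left _ _)
  have hεc := hlt.trans_le (min_le_right _ _)
  have hcg : Continuous g := continuous_iff_continuousAt.2 fun x => (hg x).continuousAt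
  -- If `g 0` is small, the cone at `y` forces slope above `c / 2` at some `t < y`. The crude bound
  -- `g' ≤ k` on `[0, t]` still gives `g t ≤ 2 * k * y`, a contradiction.
  obtain ⟨t, ⟨ht0, hty⟩, ht⟩ := exists_hasDerivAt_eq_slope g g' hy0 hcg.continuousOn
    fun x _ => hg x
  obtain ⟨s, ⟨hs0, hst⟩, hs⟩ := exists_hasDerivAt_eq_slope g g' ht0 hcg.continuousOn
    fun x _ => hg x
  have hsI : s ∈ Set.Icc 0 θ := ⟨hs0.le, by linarith⟩
  have htI : t ∈ Set.Icc 0 θ := ⟨ht0.le, by linarith⟩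
  have hgs : g' s ≤ k := by
    refine Real.le_sqrt_of_sq_le ((hd s hsI).trans ?_)
    exact mul_le_of_le_one_right hN.le (Real.rpow_le_one (h0 s hsI) (h1 s hsI) hγ.le)
  have hgt : g t ≤ 2 * k * y := by
    rw [hs, sub_zero, div_le_iff₀ ht0] at hgs
    nlinarith
  have hslope : c / 2 < g' t := by
    rw [ht, sub_zero, lt_div_iff₀ hy0]
    linarith [hcone y ⟨hy0.le, hyθ.le⟩]
  have hsq : (c / 2) ^ 2 < g' t ^ 2 := by gcongr
  have hle : N * g t ^ γ ≤ N * (2 * k * y) ^ γ := by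
    gcongr
    exact h0 t htI
  linarith [hd t htI]

end Real

/-! ### Meridians of the cap and restriction of `h` to them. -/

section Meridian

variable {n : ℕ}

/-- The upward unit vector `E_{n+1}`. -/
noncomputable def up (n : ℕ) : Space n := EuclideanSpace.single (Fin.last n) (1 : ℝ)

/-- The great circle of the sphere carrying the cap that leaves the pole in the horizontal
direction `ν`. -/
noncomputable def meridian (θ : ℝ) (ν : Space n) (t : ℝ) : Space n :=
  Real.sin t • ν + (Real.cos t - Real.cos θ) • up n

/-- The velocity of `meridian`. -/
noncomputable def meridianVelocity (ν : Space n) (t : ℝ) : Space n :=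
  Real.cos t • ν - Real.sin t • up n

theorem normal_eq_add (θ : ℝ) (ξ : Space n) : normal θ ξ = ξ + Real.cos θ • up n := by
  simp [normal, down, up]

theorem normal_meridian (θ : ℝ) (ν : Space n) (t : ℝ) :
    normal θ (meridian θ ν t) = Real.sin t • ν + Real.cos t • up n := by
  rw [normal_eq_add, meridian]; module

theorem norm_up : ‖up n‖ = 1 := by simp [up]

theorem inner_up (ν : Space n) : ⟪ν, up n⟫_ℝ = ν (Fin.last n) := by
  simp [up, EuclideanSpace.inner_single_right]

theorem up_last : up n (Fin.last n) = 1 := by simp [up]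

variable {θ : ℝ} {ν : Space n}

theorem norm_sq_smul_add (hν : ‖ν‖ = 1) (hν' : ν (Fin.last n) = 0) (a b : ℝ) :
    ‖a • ν + b • up n‖ ^ 2 = a ^ 2 + b ^ 2 := by
  rw [norm_add_sq_real, inner_smul_left, inner_smul_right, inner_up, hν', norm_smul, norm_smul,
    hν, norm_up]
  simp

theorem norm_meridianVelocity (hν : ‖ν‖ = 1) (hν' : ν (Fin.last n) = 0) (t : ℝ) :
    ‖meridianVelocity ν t‖ = 1 := by
  have h := norm_sq_smul_add hν hν' (Real.cos t) (-Real.sin t)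
  rw [neg_smul, ← sub_eq_add_neg, neg_sq, Real.cos_sq_add_sin_sq] at h
  exact (pow_eq_one_iff_of_nonneg (norm_nonneg _) two_ne_zero).1 h

theorem inner_meridianVelocity_normal (hν : ‖ν‖ = 1) (hν' : ν (Fin.last n) = 0) (t : ℝ) :
    ⟪meridianVelocity ν t, normal θ (meridian θ ν t)⟫_ℝ = 0 := by
  rw [normal_meridian, meridianVelocity]
  have h1 : ⟪up n, ν⟫_ℝ = 0 := by rw [real_inner_comm, inner_up, hν']
  simp only [inner_sub_left, inner_add_right, inner_smul_left, inner_smul_right,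
    real_inner_self_eq_norm_sq, h1, inner_up ν, hν, hν', norm_up, RCLike.conj_to_real]
  ring

theorem meridian_last (hν' : ν (Fin.last n) = 0) (t : ℝ) :
    meridian θ ν t (Fin.last n) = Real.cos t - Real.cos θ := by
  simp [meridian, hν', up_last]

theorem meridian_mem_cap (hν : ‖ν‖ = 1) (hν' : ν (Fin.last n) = 0) (hθ' : θ < Real.pi / 2)
    {t : ℝ} (ht : |t| ≤ θ) : meridian θ ν t ∈ cap n θ := by
  refine ⟨?_, ?_⟩
  · rw [meridian_last hν', ← Real.cos_abs t, sub_nonneg]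
    exact Real.cos_le_cos_of_nonneg_of_le_pi (abs_nonneg t) (by linarith [Real.pi_pos]) ht
  · change ‖normal θ (meridian θ ν t)‖ = 1
    have h := norm_sq_smul_add hν hν' (Real.sin t) (Real.cos t)
    rw [Real.sin_sq_add_cos_sq, ← normal_meridian θ] at h
    exact (pow_eq_one_iff_of_nonneg (norm_nonneg _) two_ne_zero).1 h

/-- Turns the Robin condition into an endpoint condition on the derivative along the meridian. -/
theorem conormal_meridian (hθ : Real.sin θ ≠ 0) :
    conormal θ (meridian θ ν θ) = meridianVelocity ν θ := by
  rw [conormal, meridian, meridianVelocity, sub_self, zero_smul, add_zero, smul_smul,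
    div_mul_cancel₀ _ hθ, show down n = -up n from rfl]
  module

theorem reflect_meridian (hν' : ν (Fin.last n) = 0) (t : ℝ) :
    reflect (meridian θ ν t) = meridian θ ν (-t) := by
  ext i
  by_cases hi : i = Fin.last n
  · subst hi
    simp [reflect, meridian, hν']
  · simp [reflect, meridian, up, hi]

/-- Horizontal unit vectors exist when `1 ≤ n`. -/
theorem exists_horizontal (hn : 1 ≤ n) : ∃ ν : Space n, ‖ν‖ = 1 ∧ ν (Fin.last n) = 0 := by
  refine ⟨EuclideanSpace.single 0 1, by simp, ?_⟩
  have : Fin.last n ≠ 0 := by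
    intro h
    have := congrArg Fin.val h
    simp at this
    omega
  simp [this]

theorem exists_meridian (hn : 1 ≤ n) (hθ : 0 < θ) (hθ' : θ < Real.pi / 2) {ξ : Space n}
    (hξ : ξ ∈ cap n θ) :
    ∃ ν : Space n, ‖ν‖ = 1 ∧ ν (Fin.last n) = 0 ∧ ∃ t ∈ Set.Icc 0 θ, ξ = meridian θ ν t := by
  obtain ⟨hlast, hnorm⟩ := hξ
  change ‖normal θ ξ‖ = 1 at hnorm
  set u := normal θ ξ with hu
  set a := u (Fin.last n) with ha
  set w := u - a • up n with hw
  have hw' : w (Fin.last n) = 0 := by simp [hw, up_last, ha]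
  have hacos : Real.cos θ ≤ a := by
    rw [ha, hu, normal_eq_add]; simpa [up_last] using hlast
  have hcos : 0 < Real.cos θ := Real.cos_pos_of_mem_Ioo ⟨by linarith, hθ'⟩
  have huw : u = w + a • up n := by rw [hw]; abel
  have hsq : ‖w‖ ^ 2 + a ^ 2 = 1 := by
    have h : ‖w + a • up n‖ ^ 2 = 1 := by rw [← huw, hnorm, one_pow]
    rw [norm_add_sq_real, inner_smul_right, inner_up, hw', norm_smul, norm_up] at h
    simpa using h
  have ha1 : a ≤ 1 := by nlinarith [sq_nonneg ‖w‖]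
  have hct : Real.cos (Real.arccos a) = a := Real.cos_arccos (by linarith) ha1
  have hst : Real.sin (Real.arccos a) = ‖w‖ := by
    rw [Real.sin_arccos, show 1 - a ^ 2 = ‖w‖ ^ 2 by linarith, Real.sqrt_sq (norm_nonneg _)]
  have ht : Real.arccos a ∈ Set.Icc 0 θ := by
    refine ⟨Real.arccos_nonneg a, ?_⟩
    rw [← Real.arccos_cos hθ.le (by linarith [Real.pi_pos])]
    exact Real.arccos_le_arccos hacos
  have hξ : ξ = w + (a - Real.cos θ) • up n := by
    have : ξ = u - Real.cos θ • up n := by rw [hu, normal_eq_add]; abel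
    rw [this, huw]; module
  by_cases h0 : w = 0
  -- At the pole every horizontal direction serves.
  · obtain ⟨ν, h1, h2⟩ := exists_horizontal hn
    refine ⟨ν, h1, h2, _, ht, ?_⟩
    rw [meridian, hct, hst, hξ, h0]
    simp
  · have hw0 : ‖w‖ ≠ 0 := norm_ne_zero_iff.2 h0
    refine ⟨‖w‖⁻¹ • w, ?_, ?_, _, ht, ?_⟩
    · rw [norm_smul, norm_inv, norm_norm, inv_mul_cancel₀ hw0]
    · simp [hw']
    · rw [meridian, hct, hst, smul_smul, mul_inv_cancel₀ hw0, one_smul]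
      exact hξ

theorem hasDerivAt_meridian (θ : ℝ) (ν : Space n) (t : ℝ) :
    HasDerivAt (meridian θ ν) (meridianVelocity ν t) t := by
  have h := ((Real.hasDerivAt_sin t).smul_const ν).add
    (((Real.hasDerivAt_cos t).sub_const (Real.cos θ)).smul_const (up n))
  refine h.congr_deriv ?_
  rw [meridianVelocity]; module

theorem hasDerivAt_meridianVelocity (θ : ℝ) (ν : Space n) (t : ℝ) :
    HasDerivAt (meridianVelocity ν) (-normal θ (meridian θ ν t)) t := by
  have h := ((Real.hasDerivAt_cos t).smul_const ν).sub
    ((Real.hasDerivAt_sin t).smul_const (up n))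
  refine h.congr_deriv ?_
  rw [normal_meridian]; module

variable {h : Space n → ℝ}

theorem hasDerivAt_comp_meridian (hh : ContDiff ℝ ∞ h) (θ : ℝ) (ν : Space n) (t : ℝ) :
    HasDerivAt (fun t => h (meridian θ ν t))
      (fderiv ℝ h (meridian θ ν t) (meridianVelocity ν t)) t :=
  ((hh.differentiable (by simp)) _).hasFDerivAt.comp_hasDerivAt t (hasDerivAt_meridian θ ν t)

/-- The acceleration of a unit-speed great circle is minus the normal, so the chain rule produces
exactly the correction term of the Gauss formula. -/
theorem hasDerivAt_fderiv_meridianVelocity (hh : ContDiff ℝ ∞ h) (θ : ℝ) (hν : ‖ν‖ = 1)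
    (hν' : ν (Fin.last n) = 0) (t : ℝ) :
    HasDerivAt (fun t => fderiv ℝ h (meridian θ ν t) (meridianVelocity ν t))
      (capHessian θ h (meridian θ ν t) (meridianVelocity ν t) (meridianVelocity ν t)) t := by
  have hd : Differentiable ℝ (fderiv ℝ h) :=
    (hh.fderiv_right (m := 1) (by norm_cast)).differentiable (by simp)
  have h1 : HasDerivAt (fun t => fderiv ℝ h (meridian θ ν t))
      (fderiv ℝ (fderiv ℝ h) (meridian θ ν t) (meridianVelocity ν t)) t :=
    (hd _).hasFDerivAt.comp_hasDerivAt t (hasDerivAt_meridian θ ν t)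
  refine (h1.clm_apply (hasDerivAt_meridianVelocity θ ν t)).congr_deriv ?_
  rw [capHessian, real_inner_self_eq_norm_sq, norm_meridianVelocity hν hν', map_neg,
    inner_gradient_left]
  ring

theorem fderiv_meridianVelocity (hν : ‖ν‖ = 1) (hν' : ν (Fin.last n) = 0) (t : ℝ) :
    fderiv ℝ h (meridian θ ν t) (meridianVelocity ν t) =
      ⟪capGradient θ h (meridian θ ν t), meridianVelocity ν t⟫_ℝ := by
  rw [capGradient, inner_sub_left, inner_smul_left,
    real_inner_comm (meridianVelocity ν t) (normal θ _), inner_meridianVelocity_normal hν hν', inner_gradient_left]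
  simp

/-- The comparison with `cos` and `sin` along a meridian of an even capillary support function. -/
theorem meridian_comparison (hθ : 0 < θ) (hθ' : θ < Real.pi / 2) (hh : IsCapillarySupport θ h)
    (he : IsEven θ h) (hν : ‖ν‖ = 1) (hν' : ν (Fin.last n) = 0) :
    0 < h (meridian θ ν 0) ∧
      (∀ x ∈ Set.Icc 0 θ, h (meridian θ ν 0) * Real.cos x ≤ h (meridian θ ν x)) ∧
      (∀ x ∈ Set.Icc 0 θ,
        h (meridian θ ν x) * Real.cos θ ≤ h (meridian θ ν θ) * Real.cos x) ∧
      ∀ x ∈ Set.Icc 0 θ,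
        h (meridian θ ν θ) * Real.sin x ≤ h (meridian θ ν x) * Real.sin θ := by
  have hs : 0 < Real.sin θ := Real.sin_pos_of_pos_of_lt_pi hθ (by linarith [Real.pi_pos])
  refine oscillator_comparison hθ hθ' (hasDerivAt_comp_meridian hh.smooth θ ν)
    (hasDerivAt_fderiv_meridianVelocity hh.smooth θ hν hν') (fun x hx => ?_) ?_ ?_
  · have hm : meridian θ ν x ∈ cap n θ :=
      meridian_mem_cap hν hν' hθ' (by rw [abs_of_nonneg hx.1]; exact hx.2)
    have hv := norm_meridianVelocity hν hν' x
    have := hh.strictlyConvex _ hm (meridianVelocity ν x)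
      (inner_meridianVelocity_normal hν hν' x) (norm_ne_zero_iff.1 (by rw [hv]; norm_num))
    simpa [real_inner_self_eq_norm_sq, hv] using this
  · have h1 := hasDerivAt_comp_meridian hh.smooth θ ν 0
    have h2 : HasDerivAt (fun t => h (meridian θ ν (-t)))
        (-fderiv ℝ h (meridian θ ν 0) (meridianVelocity ν 0)) 0 := by
      have h1' := h1
      rw [← neg_zero] at h1'
      simpa [Function.comp_def] using h1'.scomp (0 : ℝ) (hasDerivAt_neg (0 : ℝ))
    -- Evenness is known only on the cap, so the two functions agree only near 0; this suffices to
    -- compare derivatives.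
    have h3 : (fun t => h (meridian θ ν (-t))) =ᶠ[nhds 0] fun t => h (meridian θ ν t) := by
      filter_upwards [Ioo_mem_nhds (neg_lt_zero.2 hθ) hθ] with t ht
      rw [← reflect_meridian hν']
      exact he _ (meridian_mem_cap hν hν' hθ' (abs_le.2 ⟨ht.1.le, ht.2.le⟩))
    have := (h2.congr_of_eventuallyEq h3.symm).unique h1
    linarith
  · have hb : meridian θ ν θ ∈ capBoundary n θ :=
      ⟨meridian_mem_cap hν hν' hθ' (by rw [abs_of_pos hθ]), by rw [meridian_last hν', sub_self]⟩
    have := hh.robin _ hb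
    rw [conormal_meridian hs.ne', ← fderiv_meridianVelocity hν hν'] at this
    rw [this]
    field_simp

theorem isCompact_cap (n : ℕ) (θ : ℝ) : IsCompact (cap n θ) := by
  refine Metric.isCompact_of_isClosed_isBounded ?_ ?_
  · have h1 : IsClosed {ζ : Space n | 0 ≤ ζ (Fin.last n)} :=
      isClosed_le (by fun_prop) (by fun_prop)
    have h2 : IsClosed {ζ : Space n | ‖ζ - Real.cos θ • down n‖ = 1} :=
      isClosed_eq (by fun_prop) (by fun_prop)
    exact h1.inter h2
  · refine (Metric.isBounded_sphere (x := Real.cos θ • down n) (r := 1)).subset fun ξ hξ => ?_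
    rw [mem_sphere_iff_norm]
    exact hξ.2

end Meridian

end Capillary

/-! ### The ratio bound. -/

open Capillary

theorem lemma4p1 (n : ℕ) (hn : 1 ≤ n) (θ : ℝ) (hθ : 0 < θ) (hθ' : θ < Real.pi / 2)
    (γ N : ℝ) (hγ : 0 < γ) (hN : 0 < N) :
    ∃ C : ℝ, ∀ h : Capillary.Space n → ℝ,
      Capillary.IsCapillarySupport θ h →
      Capillary.IsEven θ h →
      (∀ ξ ∈ Capillary.cap n θ,
        ‖Capillary.capGradient θ h ξ‖ ^ 2 / h ξ ^ γ ≤ N * Capillary.capMax θ h ^ (2 - γ)) →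
      0 < Capillary.capMin θ h ∧ Capillary.capMax θ h / Capillary.capMin θ h ≤ C := by
  have hs : 0 < Real.sin θ := Real.sin_pos_of_pos_of_lt_pi hθ (by linarith [Real.pi_pos])
  have hc : 0 < Real.cos θ := Real.cos_pos_of_mem_Ioo ⟨by linarith, hθ'⟩
  have hπ := Real.pi_pos
  -- Cone slope: `cos θ` from the endpoint value, `1 / sin θ` from the comparison with `sin`, and `2
  -- / π` from Jordan's inequality.
  obtain ⟨ε, hε, hlow⟩ := exists_lower_bound_at_zero (c := Real.cos θ / Real.sin θ *
    (2 / Real.pi)) hθ (by positivity) hγ hN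
  refine ⟨1 / (ε * Real.cos θ), fun h hh he hgrad => ?_⟩
  obtain ⟨ν₀, hν₀, hν₀'⟩ := exists_horizontal hn
  have hne : (cap n θ).Nonempty :=
    ⟨_, meridian_mem_cap hν₀ hν₀' hθ' (t := 0) (by simpa using hθ.le)⟩
  have hcont : ContinuousOn h (cap n θ) := hh.smooth.continuous.continuousOn
  obtain ⟨ξ, hξ, hmin⟩ := (isCompact_cap n θ).exists_isMinOn hne hcont
  obtain ⟨ζ, hζ, hmax⟩ := (isCompact_cap n θ).exists_isMaxOn hne hcont
  have hMin : capMin θ h = h ξ :=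
    IsLeast.csInf_eq ⟨⟨ξ, hξ, rfl⟩, by rintro _ ⟨x, hx, rfl⟩; exact hmin hx⟩
  have hMax : capMax θ h = h ζ :=
    IsGreatest.csSup_eq ⟨⟨ζ, hζ, rfl⟩, by rintro _ ⟨x, hx, rfl⟩; exact hmax hx⟩
  rw [hMax] at hgrad
  rw [hMin, hMax]
  obtain ⟨ν, hν, hν', t, ht, hξt⟩ := exists_meridian hn hθ hθ' hξ
  obtain ⟨τ, hτ, hτ', s, hs', hζs⟩ := exists_meridian hn hθ hθ' hζ
  obtain ⟨hp, hcosν, -, -⟩ := meridian_comparison hθ hθ' hh he hν hν'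
  obtain ⟨-, -, hcosτ, hsinτ⟩ := meridian_comparison hθ hθ' hh he hτ hτ'
  have hpole : meridian θ τ 0 = meridian θ ν 0 := by simp [meridian]
  have hξ_ge : h (meridian θ ν 0) * Real.cos θ ≤ h ξ := by
    rw [hξt]
    refine le_trans ?_ (hcosν t ht)
    gcongr
    exact Real.cos_le_cos_of_nonneg_of_le_pi ht.1 (by linarith) ht.2
  have hξ_pos : 0 < h ξ := (mul_pos hp hc).trans_le hξ_ge
  have hpos : ∀ x ∈ cap n θ, 0 < h x := fun x hx => hξ_pos.trans_le (hmin hx)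
  have hM : 0 < h ζ := hpos ζ hζ
  have hmem : ∀ x ∈ Set.Icc 0 θ, meridian θ τ x ∈ cap n θ := fun x hx =>
    meridian_mem_cap hτ hτ' hθ' (by rw [abs_of_nonneg hx.1]; exact hx.2)
  have hend : h ζ * Real.cos θ ≤ h (meridian θ τ θ) := by
    rw [hζs]
    refine (hcosτ s hs').trans ?_
    exact mul_le_of_le_one_right (hpos _ (hmem θ ⟨hθ.le, le_rfl⟩)).le (Real.cos_le_one s)
  have hε0 : ε ≤ h (meridian θ τ 0) / h ζ := by
    refine hlow (fun x => h (meridian θ τ x) / h ζ)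
      (fun x => fderiv ℝ h (meridian θ τ x) (meridianVelocity τ x) / h ζ)
      (fun x => (hasDerivAt_comp_meridian hh.smooth θ τ x).div_const _)
      (fun x hx => (div_pos (hpos _ (hmem x hx)) hM).le)
      (fun x hx => (div_le_one hM).2 (hmax (hmem x hx))) (fun x hx => ?_) (fun x hx => ?_)
    · have hx0 := hpos _ (hmem x hx)
      have h1 := hgrad _ (hmem x hx)
      rw [div_le_iff₀ (Real.rpow_pos_of_pos hx0 γ)] at h1
      have h2 : |fderiv ℝ h (meridian θ τ x) (meridianVelocity τ x)| ≤
          ‖capGradient θ h (meridian θ τ x)‖ := by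
        rw [fderiv_meridianVelocity (θ := θ) hτ hτ']
        refine (abs_real_inner_le_norm _ _).trans ?_
        rw [norm_meridianVelocity hτ hτ', mul_one]
      have h3 := (sq_le_sq' (neg_le_of_abs_le h2) (le_of_abs_le h2)).trans h1
      -- The exponent `2 - γ` is what lets the maximum scale out of the gradient bound.
      have h4 : h ζ ^ (2 - γ) = h ζ ^ 2 / h ζ ^ γ := by
        rw [Real.rpow_sub hM, Real.rpow_two]
      rw [h4] at h3
      rw [div_pow, div_le_iff₀ (by positivity), Real.div_rpow hx0.le hM.le]
      refine h3.trans_eq ?_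
      ring
    · rw [le_div_iff₀ hM]
      have h1 := Real.mul_le_sin hx.1 (hx.2.trans hθ'.le)
      have h2 := hsinτ x hx
      have h3 : h ζ * Real.cos θ * (2 / Real.pi * x) ≤
          h (meridian θ τ θ) * Real.sin x := by
        have := hx.1
        exact mul_le_mul hend h1 (by positivity) (hpos _ (hmem θ ⟨hθ.le, le_rfl⟩)).le
      have h4 := (div_le_iff₀ hs).2 (h3.trans h2)
      refine le_of_eq_of_le ?_ h4
      ring
  rw [hpole, le_div_iff₀ hM] at hε0
  refine ⟨hξ_pos, ?_⟩
  rw [div_le_div_iff₀ hξ_pos (by positivity), one_mul]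
  calc h ζ * (ε * Real.cos θ) = ε * h ζ * Real.cos θ := by ring
    _ ≤ h (meridian θ ν 0) * Real.cos θ := by gcongr
    _ ≤ h ξ := hξ_ge
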